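/- Let $g:\mathbb R\to\mathbb R$ be nondecreasing and left-continuous, and let $\mu_g$ be its Lebesgue–Stieltjes measure, $\mu_g([c,d))=g(d)-g(c)$. Put $\Delta g(t)=g(t^+)-g(t)$, $D_g=\{t:\Delta g(t)>0\}$, and let $C_g$ be the open set of all $t$ such that $g$ is constant on a neighbourhood of $t$. Let $N_g^-$ and $N_g^+$ be the sets of the finite left, respectively right, endpoints of the connected components of $C_g$ that do not belong to $D_g$. Let $T>0$ with $0\notin D_g\cup N_g^-$ and $T\notin N_g^+\cup D_g\cup C_g$. For $t\in[0,T]$ let $t^*=t$ if $t\notin C_g$, and let $t^*$ be the right endpoint of the component of $C_g$ that contains $t$ if $t\in C_g$. The $g$-derivative of $f:[0,T]\to\mathbb C$ at $t$ is $$f_g'(t)=\lim_{s\to t}\frac{f(s)-f(t)}{g(s)-g(t)}\ \ (t\notin D_g\cup C_g),\qquad f_g'(t)=\lim_{s\to t^{*+}}\frac{f(s)-f(t^*)}{g(s)-g(t^*)}\ \ (t\in D_g\cup C_g),$$ if the limit exists, where the first limit is taken over $s\in[0,T]$ with $g(s)\ne g(t)$. A function $f:[0,T]\to\mathbb C$ is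 $g$-continuous if for all $t\in[0,T]$ and $\varepsilon>0$ there is $\delta>0$ such that $|f(t)-f(s)|<\varepsilon$ for all $s\in[0,T]$ with $|g(t)-g(s)|<\delta$. $\mathcal{BC}_g$ is the set of bounded $g$-continuous functions $[0,T]\to\mathbb C$, and $\mathcal{BC}_g^2$ is the set of all $f\in\mathcal{BC}_g$ for which $f_g'$ and $f_g''=(f_g')_g'$ exist everywhere on $[0,T]$ and belong to $\mathcal{BC}_g$. A function $p:[0,T]\to\mathbb C$ is regressive if $1+p(t)\Delta g(t)\ne0$ for all $t\in[0,T]\cap D_g$. For regressive $p\in\mathcal L^1_g([0,T);\mathbb C)$ let $$\exp_g(p;t)=\exp\Big(\int_{[0,t)}\tilde p\,d\mu_g\Big),\quad t\in[0,T],$$ where $\tilde p(s)=p(s)$ for $s\notin D_g$ and $\tilde p(s)=\ln(1+p(s)\Delta g(s))/\Delta g(s)$ for $s\in D_g$, with the principal logarithm. Let $P,Q\in\mathcal{BC}_g$ and let $y_1,y_2\in\mathcal{BC}_g^2$ be two solutions of $v_g''(t)+P(t)v_g'(t)+Q(t)v(t)=0$, $t\in[0,T]$. Put $$W_g(y_1,y_2)=\begin{vmatrix}y_1&y_2&(\Delta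 g)^2\\(y_1)_g'&(y_2)_g'&-\Delta g\\(y_1)_g''&(y_2)_g''&1\end{vmatrix},\qquad \widetilde W_g(y_1,y_2)=\begin{vmatrix}y_1&y_2\\(y_1)_g'&(y_2)_g'\end{vmatrix}.$$ Then, on $[0,T]$, $$W_g(y_1,y_2)=(1-P\Delta g+Q(\Delta g)^2)\,\widetilde W_g(y_1,y_2).$$ Suppose moreover that $1-P(t)\Delta g(t)+Q(t)\Delta g(t)^2\neq0$ for all $t\in[0,T]\cap D_g$. Then $-P+Q\Delta g$ is regressive and belongs to $\mathcal L^1_g([0,T);\mathbb C)$, the integral that defines its $g$-exponential converges absolutely, and, on $[0,T]$, $$\widetilde W_g(y_1,y_2)=\widetilde W_g(y_1,y_2)(0)\,\exp_g(-P+Q\Delta g;\cdot).$$ If in addition $\widetilde W_g(y_1,y_2)(0)\ne0$, then $W_g(y_1,y_2)(t)\ne0$ for every $t\in[0,T]$, the function $-\frac{-P+Q\Delta g}{1-P\Delta g+Q(\Delta g)^2}$ is likewise regressive and in $\mathcal L^1_g([0,T);\mathbb C)$ with an absolutely convergent integral in its $g$-exponential, and, on $[0,T]$, $$W_g(y_1,y_2)^{-1}=\big[\widetilde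 W_g(y_1,y_2)(0)\,(1-P\Delta g+Q(\Delta g)^2)\big]^{-1}\exp_g\Big(-\frac{-P+Q\Delta g}{1-P\Delta g+Q(\Delta g)^2};\cdot\Big);$$ this function is bounded on $[0,T]$ and continuous (in the usual sense, as a function on $[0,T]$) at every point of $[0,T]\setminus D_g$. -/

import Mathlib

open Set Filter Topology MeasureTheory

/-- A derivator: a nondecreasing, left-continuous function `g : ℝ → ℝ`. -/
structure Derivator where
  toFun : ℝ → ℝ
  mono : Monotone toFun
  leftCont : ∀ t, ContinuousWithinAt toFun (Iic t) t

namespace Derivator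

instance : CoeFun Derivator (fun _ => ℝ → ℝ) := ⟨Derivator.toFun⟩

/-- The Lebesgue–Stieltjes measure `μ_g`, with `μ_g [c,d) = g d - g c` (see `mu_Ico`).
Mathlib's Stieltjes functions are right-continuous, so it is built from `t ↦ g (t⁺)`. -/
noncomputable def mu (g : Derivator) : Measure ℝ := g.mono.stieltjesFunction.measure

theorem mu_Ico (g : Derivator) (c d : ℝ) : g.mu (Ico c d) = ENNReal.ofReal (g d - g c) := by
  have key : ∀ x, Function.leftLim g.mono.stieltjesFunction x = g x := by
    intro x
    have h1 : Function.leftLim (g.toFun) x = g x :=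
      (g.mono.continuousWithinAt_Iio_iff_leftLim_eq).1
        ((g.leftCont x).mono Iio_subset_Iic_self)
    have h2 : Function.leftLim (Function.rightLim g.toFun) x = Function.leftLim g.toFun x :=
      leftLim_rightLim (g.mono.tendsto_leftLim x)
    rw [← h1, ← h2]
    congr 1
  rw [mu, StieltjesFunction.measure_Ico, key, key]

/-- The jump `Δg(t) = g(t⁺) - g(t)`. -/
noncomputable def jump (g : Derivator) (t : ℝ) : ℝ := Function.rightLim g.toFun t - g t

/-- `C_g`: the points around which `g` is constant. -/
def constSet (g : Derivator) : Set ℝ :=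
  {t | ∃ ε > 0, ∀ s ∈ Ioo (t - ε) (t + ε), g s = g t}

/-- `D_g`: the discontinuity points of `g`. -/
def jumpSet (g : Derivator) : Set ℝ := {t | 0 < g.jump t}

/-- `N_g⁻`: the (finite) left endpoints of the connected components of the open set `C_g`
that do not belong to `D_g`. -/
def leftEnds (g : Derivator) : Set ℝ :=
  {a | a ∉ g.constSet ∧ ∃ b > a, Ioo a b ⊆ g.constSet} \ g.jumpSet

/-- `N_g⁺`: the (finite) right endpoints of the connected components of the open set `C_g`
that do not belong to `D_g`. -/
def rightEnds (g : Derivator) : Set ℝ :=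
  {b | b ∉ g.constSet ∧ ∃ a < b, Ioo a b ⊆ g.constSet} \ g.jumpSet

open Classical in
/-- `t*`: equal to `t` if `t ∉ C_g`, and to the right endpoint of the connected component of
`C_g` that contains `t` if `t ∈ C_g` (see `star_eq`). -/
noncomputable def star (g : Derivator) (t : ℝ) : ℝ :=
  if t ∈ g.constSet then sInf {s | t ≤ s ∧ s ∉ g.constSet} else t

theorem star_eq (g : Derivator) {a b t : ℝ} (hab : Ioo a b ⊆ g.constSet)
    (hb : b ∉ g.constSet) (ht : t ∈ Ioo a b) : g.star t = b := by
  have hl : IsLeast {s | t ≤ s ∧ s ∉ g.constSet} b :=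
    ⟨⟨ht.2.le, hb⟩, fun s hs => not_lt.1 fun h => hs.2 (hab ⟨ht.1.trans_le hs.1, h⟩)⟩
  rw [star, if_pos (hab ht)]
  exact hl.csInf_eq

open Classical in
/-- The filter along which the limit defining the `g`-derivative at `t` of a function on `[0,T]`
is taken: `s → t*` from the right if `t ∈ D_g ∪ C_g`, and otherwise `s → t` with `s ∈ [0,T]`,
`g s ≠ g t`, the set where the quotient is defined (this is a one-sided limit at points of
`N_g⁻ ∪ N_g⁺ ∪ {0, T}`). -/
noncomputable def derivFilter (g : Derivator) (T t : ℝ) : Filter ℝ :=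
  if t ∈ g.jumpSet ∪ g.constSet then 𝓝[Ioc (g.star t) T] (g.star t)
  else 𝓝[{s | s ∈ Icc 0 T ∧ g s ≠ g t}] t

/-- The difference quotient of `f` with respect to `g` at `t*`. -/
noncomputable def quot (g : Derivator) (f : ℝ → ℂ) (t s : ℝ) : ℂ :=
  (f s - f (g.star t)) / ((g s - g (g.star t) : ℝ) : ℂ)

/-- `f : [0,T] → ℂ` is `g`-differentiable at `t`. Functions on `[0,T]` are represented by functions
on `ℝ`, of which only the values on `[0,T]` matter. -/
def DiffAt (g : Derivator) (T : ℝ) (f : ℝ → ℂ) (t : ℝ) : Prop :=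
  ∃ d : ℂ, Tendsto (g.quot f t) (g.derivFilter T t) (𝓝 d)

/-- The `g`-derivative of `f : [0,T] → ℂ`. -/
noncomputable def deriv (g : Derivator) (T : ℝ) (f : ℝ → ℂ) (t : ℝ) : ℂ :=
  limUnder (g.derivFilter T t) (g.quot f t)

/-- The iterated `g`-derivative `f_g^{(n)}` on `[0,T]`. -/
noncomputable def iterDeriv (g : Derivator) (T : ℝ) : ℕ → (ℝ → ℂ) → ℝ → ℂ
  | 0, f => f
  | n + 1, f => g.deriv T (iterDeriv g T n f)

/-- `f ∈ C_g([0,T]; ℂ)`: `f` is `g`-continuous on `[0,T]`. -/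
def MemC (g : Derivator) (T : ℝ) (f : ℝ → ℂ) : Prop :=
  ∀ t ∈ Icc 0 T, ∀ ε > 0, ∃ δ > 0, ∀ s ∈ Icc 0 T, |g t - g s| < δ → ‖f t - f s‖ < ε

/-- `f ∈ BC_g([0,T]; ℂ)`: `f` is `g`-continuous and bounded on `[0,T]`. -/
def MemBC (g : Derivator) (T : ℝ) (f : ℝ → ℂ) : Prop :=
  g.MemC T f ∧ ∃ M : ℝ, ∀ t ∈ Icc 0 T, ‖f t‖ ≤ M

/-- `f ∈ C_g^k([0,T]; ℂ)`. -/
def MemCk (g : Derivator) (T : ℝ) : ℕ → (ℝ → ℂ) → Prop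
  | 0, f => g.MemC T f
  | k + 1, f => MemCk g T k f ∧ (∀ t ∈ Icc 0 T, g.DiffAt T (g.iterDeriv T k f) t) ∧
      g.MemC T (g.iterDeriv T (k + 1) f)

/-- `f ∈ BC_g^k([0,T]; ℂ)`. -/
def MemBCk (g : Derivator) (T : ℝ) (k : ℕ) (f : ℝ → ℂ) : Prop :=
  g.MemCk T k f ∧ ∀ n ≤ k, g.MemBC T (g.iterDeriv T n f)

/-- `p` is regressive on `[0,T]`. -/
def Regressive (g : Derivator) (T : ℝ) (p : ℝ → ℂ) : Prop :=
  ∀ t ∈ Icc 0 T ∩ g.jumpSet, 1 + p t * g.jump t ≠ 0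

open Classical in
/-- The function `p̃` in the definition of the `g`-exponential. -/
noncomputable def expIntegrand (g : Derivator) (p : ℝ → ℂ) (s : ℝ) : ℂ :=
  if s ∈ g.jumpSet then Complex.log (1 + p s * g.jump s) / g.jump s else p s

/-- The `g`-exponential `exp_g(p; t) = exp (∫_{[0,t)} p̃ dμ_g)`. -/
noncomputable def gexp (g : Derivator) (p : ℝ → ℂ) (t : ℝ) : ℂ :=
  Complex.exp (∫ s in Ico 0 t, g.expIntegrand p s ∂g.mu)

/-- The `g`-exponential of `p` on `[0,T]` is well defined: `p` is regressive and belongs to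
`L¹_g([0,T); ℂ)`, and the integral in the definition of `gexp` converges absolutely. -/
def GexpDefined (g : Derivator) (T : ℝ) (p : ℝ → ℂ) : Prop :=
  g.Regressive T p ∧ IntegrableOn p (Ico 0 T) g.mu ∧
    IntegrableOn (g.expIntegrand p) (Ico 0 T) g.mu

/-- `v` is a solution of `v_g'' + P v_g' + Q v = f` on `[0,T]`. -/
def IsSolution (g : Derivator) (T : ℝ) (P Q f v : ℝ → ℂ) : Prop :=
  g.MemBCk T 2 v ∧
    ∀ t ∈ Icc 0 T, g.iterDeriv T 2 v t + P t * g.iterDeriv T 1 v t + Q t * v t = f t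

/-- The `g`-Wronskian `W_g(y₁,y₂)`. -/
noncomputable def wronskian (g : Derivator) (T : ℝ) (y₁ y₂ : ℝ → ℂ) (t : ℝ) : ℂ :=
  Matrix.det !![y₁ t, y₂ t, (g.jump t : ℂ) ^ 2;
    g.iterDeriv T 1 y₁ t, g.iterDeriv T 1 y₂ t, -(g.jump t : ℂ);
    g.iterDeriv T 2 y₁ t, g.iterDeriv T 2 y₂ t, 1]

/-- The simplified `g`-Wronskian `W̃_g(y₁,y₂)`. -/
noncomputable def simpleWronskian (g : Derivator) (T : ℝ) (y₁ y₂ : ℝ → ℂ) (t : ℝ) : ℂ :=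
  Matrix.det !![y₁ t, y₂ t; g.iterDeriv T 1 y₁ t, g.iterDeriv T 1 y₂ t]

end Derivator

namespace Derivator

variable (g : Derivator) {T t : ℝ}

/-! ### Jumps and the measure of a derivator -/

/-! The identity between the two Wronskians is linear algebra: expand along the last row and
eliminate the second derivatives by the equation. The rest is a uniqueness argument for `f_g' = p f`
with `p = -P + Q Δg`, which uses only limits from the right.

The product rule for right `g`-derivatives shows that the simple Wronskian solves this equation
(`hasRightDeriv_simpleWronskian`). So does `gexp p`: the logarithm in its integrand is made for the
jumps, and right continuity of the integrand suffices elsewhere (`hasRightDeriv_gexp`). With `q = -p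
/ (1 + p Δg)` one has `(1 + p Δg)(1 + q Δg) = 1`, so any `g`-continuous solution times `gexp q` has
right `g`-derivative zero. Such a function is constant by a supremum argument
(`MemC.eq_of_hasRightDeriv_zero`), in which left continuity of `g` replaces derivatives from the
left. Applied to the simple Wronskian and to `gexp p`, this yields both exponential formulas.

Bounds come from the fact that only finitely many jumps in `[0,T]` exceed a given size; where jumps
are small, `1 + p Δg` is close to 1. -/

theorem jump_nonneg (t : ℝ) : 0 ≤ g.jump t :=
  sub_nonneg.2 (g.mono.le_rightLim le_rfl)

variable {g} in
theorem jump_eq_zero (h : t ∉ g.jumpSet) : g.jump t = 0 :=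
  le_antisymm (not_lt.1 h) (g.jump_nonneg t)

theorem leftLim_eq (t : ℝ) : Function.leftLim g.toFun t = g t :=
  g.mono.continuousWithinAt_Iio_iff_leftLim_eq.1 ((g.leftCont t).mono Iio_subset_Iic_self)

theorem leftLim_stieltjesFunction (t : ℝ) :
    Function.leftLim g.mono.stieltjesFunction t = g t := by
  have h : Function.leftLim (Function.rightLim g.toFun) t = Function.leftLim g.toFun t :=
    leftLim_rightLim (g.mono.tendsto_leftLim t)
  rw [← g.leftLim_eq t, ← h]
  congr 1

theorem rightLim_eq (t : ℝ) : Function.rightLim g.toFun t = g t + g.jump t := by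
  rw [jump]; ring

theorem mu_singleton (t : ℝ) : g.mu {t} = ENNReal.ofReal (g.jump t) := by
  rw [mu, StieltjesFunction.measure_singleton, leftLim_stieltjesFunction]
  rfl

theorem mu_Ioo (t s : ℝ) : g.mu (Ioo t s) = ENNReal.ofReal (g s - g t - g.jump t) := by
  rw [mu, StieltjesFunction.measure_Ioo, leftLim_stieltjesFunction]
  change ENNReal.ofReal (g s - Function.rightLim g.toFun t) = _
  rw [rightLim_eq, sub_add_eq_sub_sub]

instance : IsLocallyFiniteMeasure g.mu := by
  rw [mu]; infer_instance

variable {g} in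
theorem continuousAt_of_notMem_jumpSet (h : t ∉ g.jumpSet) : ContinuousAt g.toFun t := by
  rw [g.mono.continuousAt_iff_leftLim_eq_rightLim, g.leftLim_eq, g.rightLim_eq, jump_eq_zero h,
    add_zero]

theorem tendsto_right (t : ℝ) : Tendsto g.toFun (𝓝[>] t) (𝓝 (g t + g.jump t)) := by
  rw [← rightLim_eq]
  exact g.mono.tendsto_rightLim t

/-- Both `g` and its right-limit function tend to the right limit of `g` at `t`, so their difference
vanishes in the limit, even when `t` is itself a jump. -/
theorem tendsto_jump_right (t : ℝ) : Tendsto g.jump (𝓝[>] t) (𝓝 0) := by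
  have h1 : Tendsto (Function.rightLim g.toFun) (𝓝[>] t) (𝓝 (Function.rightLim g.toFun t)) :=
    (g.mono.stieltjesFunction.right_continuous t).mono_left (nhdsWithin_mono _ Ioi_subset_Ici_self)
  have h2 := h1.sub (g.mono.tendsto_rightLim t)
  rwa [sub_self] at h2

variable {g} in
theorem continuousAt_jump (h : t ∉ g.jumpSet) : ContinuousAt g.jump t := by
  have h1 : ContinuousAt (Function.rightLim g.toFun) t := by
    rw [g.mono.rightLim.continuousAt_iff_leftLim_eq_rightLim,
      leftLim_rightLim (g.mono.tendsto_leftLim t), rightLim_rightLim (g.mono.tendsto_rightLim t),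
      g.leftLim_eq, g.rightLim_eq, jump_eq_zero h, add_zero]
  exact h1.sub (continuousAt_of_notMem_jumpSet h)

theorem measurable_jump : Measurable g.jump :=
  g.mono.rightLim.measurable.sub g.mono.measurable

/-- Jumps are the masses of atoms of `μ_g`, and a compact interval has finite measure. -/
theorem finite_setOf_le_jump (T : ℝ) {c : ℝ} (hc : 0 < c) :
    {t | t ∈ Icc 0 T ∧ c ≤ g.jump t}.Finite := by
  by_contra h
  have h1 : g.mu {t | t ∈ Icc 0 T ∧ c ≤ g.jump t} = ⊤ :=
    Set.Infinite.meas_eq_top h ⟨ENNReal.ofReal c, by simpa using hc, fun x hx => by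
      rw [mu_singleton]; exact ENNReal.ofReal_le_ofReal hx.2⟩
  have h2 : g.mu (Icc 0 T) < ⊤ := isCompact_Icc.measure_lt_top
  exact ((measure_mono fun x hx => hx.1 : _ ≤ g.mu (Icc 0 T)).trans_lt h2).ne h1

variable {g} in
/-- Boundedness on `[0,T]` has to be checked only where the jumps are small. -/
theorem exists_bound_of_small_jump {h : ℝ → ℂ} {c B : ℝ} (hc : 0 < c)
    (hB : ∀ t ∈ Icc 0 T, g.jump t < c → ‖h t‖ ≤ B) : ∃ M : ℝ, ∀ t ∈ Icc 0 T, ‖h t‖ ≤ M := by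
  obtain ⟨M, hM⟩ := ((g.finite_setOf_le_jump T hc).image fun t => ‖h t‖).bddAbove
  refine ⟨max B M, fun t ht => ?_⟩
  rcases lt_or_ge (g.jump t) c with h1 | h1
  · exact (hB t ht h1).trans (le_max_left _ _)
  · exact (hM ⟨t, ⟨ht, h1⟩, rfl⟩).trans (le_max_right _ _)

/-! ### `g`-continuous functions -/

variable {g} {f h : ℝ → ℂ}

/-- This is continuity for the topology induced by `g`; algebraic closure properties then follow
from those of limits. -/
theorem memC_iff : g.MemC T f ↔
    ∀ t ∈ Icc 0 T, Tendsto f (comap g.toFun (𝓝 (g t)) ⊓ 𝓟 (Icc 0 T)) (𝓝 (f t)) := by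
  refine forall₂_congr fun t _ => ?_
  rw [((Metric.nhds_basis_ball.comap g.toFun).inf_principal (Icc 0 T)).tendsto_iff
    Metric.nhds_basis_ball]
  refine forall₂_congr fun ε _ => exists_congr fun δ => and_congr_right fun _ => ?_
  simp only [mem_inter_iff, mem_preimage, Metric.mem_ball, and_imp]
  refine forall_congr' fun s => ?_
  rw [dist_comm (g s), dist_comm (f s), Real.dist_eq, dist_eq_norm]
  tauto

theorem MemC.mul (hf : g.MemC T f) (hh : g.MemC T h) : g.MemC T fun t => f t * h t :=
  memC_iff.2 fun t ht => (memC_iff.1 hf t ht).mul (memC_iff.1 hh t ht)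

theorem MemC.sub (hf : g.MemC T f) (hh : g.MemC T h) : g.MemC T fun t => f t - h t :=
  memC_iff.2 fun t ht => (memC_iff.1 hf t ht).sub (memC_iff.1 hh t ht)

theorem MemC.eq_of_eq (hf : g.MemC T f) {s : ℝ} (ht : t ∈ Icc 0 T) (hs : s ∈ Icc 0 T)
    (hst : g s = g t) : f s = f t := by
  by_contra hne
  obtain ⟨δ, hδ, H⟩ := hf t ht ‖f t - f s‖ (norm_pos_iff.2 (sub_ne_zero.2 (Ne.symm hne)))
  exact lt_irrefl _ (H s hs (by rw [hst]; simpa using hδ))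

theorem MemC.tendsto (hf : g.MemC T f) (ht : t ∈ Icc 0 T) {l : Filter ℝ}
    (hl : ∀ᶠ s in l, s ∈ Icc 0 T) (hg : Tendsto g.toFun l (𝓝 (g t))) : Tendsto f l (𝓝 (f t)) :=
  (memC_iff.1 hf t ht).mono_left (le_inf hg.le_comap (le_principal_iff.2 hl))

theorem MemC.continuousWithinAt (hf : g.MemC T f) (ht : t ∈ Icc 0 T) (hj : t ∉ g.jumpSet) :
    ContinuousWithinAt f (Icc 0 T) t :=
  hf.tendsto ht self_mem_nhdsWithin (continuousAt_of_notMem_jumpSet hj).continuousWithinAt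

theorem MemC.aemeasurable (hf : g.MemC T f) : AEMeasurable f (g.mu.restrict (Icc 0 T)) := by
  refine aemeasurable_restrict_of_measurable_subtype measurableSet_Icc
    (measurable_of_isOpen fun U hU => ?_)
  -- An open set whose preimage under `g` is the preimage of `U` under `f`; measurability is thereby
  -- inherited from the monotone `g`.
  set V : Set ℝ := ⋃₀ {B | IsOpen B ∧ ∀ s ∈ Icc 0 T, g s ∈ B → f s ∈ U} with hV
  have hVo : IsOpen V := isOpen_sUnion fun B hB => hB.1
  have hVU : (fun x : Icc (0 : ℝ) T => f x) ⁻¹' U = (fun x : Icc (0 : ℝ) T => g x) ⁻¹' V := by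
    ext x
    refine ⟨fun hx => ?_, fun ⟨B, hB, hxB⟩ => hB.2 x x.2 hxB⟩
    have h1 := memC_iff.1 hf x x.2 (hU.mem_nhds hx)
    rw [mem_map, mem_inf_principal] at h1
    obtain ⟨B, hB, hBU⟩ := mem_comap.1 h1
    obtain ⟨O, hOB, hO, hxO⟩ := mem_nhds_iff.1 hB
    exact ⟨O, ⟨hO, fun s hs hsO => hBU (hOB hsO) hs⟩, hxO⟩
  rw [hVU]
  exact (g.mono.measurable.comp measurable_subtype_coe) hVo.measurableSet

/-! ### Right `g`-derivatives -/

/-- A `g`-continuous function whose increments to the right are `o(g s - g t)` is constant. -/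
theorem MemC.eq_of_eventually_le (hf : g.MemC T f)
    (h : ∀ t ∈ Ico 0 T, ∀ ε > 0, ∀ᶠ s in 𝓝[>] t, ‖f s - f t‖ ≤ ε * (g s - g t))
    (ht : t ∈ Icc 0 T) : f t = f 0 := by
  have hT : 0 ≤ T := ht.1.trans ht.2
  have key : ∀ ε > 0, ‖f t - f 0‖ ≤ ε * (g t - g 0) := by
    intro ε hε
    -- The estimate reaches `sSup S` by left continuity of `g`, and the hypothesis carries it past
    -- any point before `T`; hence the supremum is `T`.
    set S : Set ℝ := {t | t ∈ Icc 0 T ∧ ∀ s ∈ Icc 0 t, ‖f s - f 0‖ ≤ ε * (g s - g 0)} with hS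
    have h0S : (0 : ℝ) ∈ S := by
      refine ⟨⟨le_rfl, hT⟩, fun s hs => ?_⟩
      obtain rfl : s = 0 := le_antisymm hs.2 hs.1
      simp
    have hbdd : BddAbove S := ⟨T, fun s hs => hs.1.2⟩
    set x := sSup S with hx
    have hx0 : 0 ≤ x := le_csSup hbdd h0S
    have hxT : x ≤ T := csSup_le ⟨0, h0S⟩ fun s hs => hs.1.2
    have hlt : ∀ s ∈ Ico 0 x, ‖f s - f 0‖ ≤ ε * (g s - g 0) := fun s hs => by
      obtain ⟨u, hu, hsu⟩ := exists_lt_of_lt_csSup ⟨0, h0S⟩ hs.2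
      exact hu.2 s ⟨hs.1, hsu.le⟩
    have hxx : ‖f x - f 0‖ ≤ ε * (g x - g 0) := by
      rcases hx0.eq_or_lt with h1 | h1
      · rw [← h1]; simp
      have hne : (𝓝[Ico 0 x] x).NeBot := by
        rw [nhdsWithin_Ico_eq_nhdsLT h1]; infer_instance
      have hg : Tendsto g.toFun (𝓝[Ico 0 x] x) (𝓝 (g x)) :=
        (g.leftCont x).mono_left (nhdsWithin_mono _ fun s hs => hs.2.le)
      have hmem : ∀ᶠ s in 𝓝[Ico 0 x] x, s ∈ Ico 0 x := self_mem_nhdsWithin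
      have hft := hf.tendsto ⟨hx0, hxT⟩ (hmem.mono fun s hs => ⟨hs.1, hs.2.le.trans hxT⟩) hg
      exact le_of_tendsto_of_tendsto (hft.sub_const _).norm ((hg.sub_const _).const_mul _)
        (hmem.mono hlt)
    have hle : ∀ s ∈ Icc 0 x, ‖f s - f 0‖ ≤ ε * (g s - g 0) := fun s hs => by
      rcases hs.2.eq_or_lt with h1 | h1
      · rw [h1]; exact hxx
      · exact hlt s ⟨hs.1, h1⟩
    rcases hxT.eq_or_lt with h1 | h1
    · exact hle t (h1 ▸ ht)
    · exfalso
      have h2 := (h x ⟨hx0, h1⟩ ε hε).and (Ioo_mem_nhdsGT h1)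
      obtain ⟨u, hu, hu2⟩ := mem_nhdsGT_iff_exists_Ioc_subset.1 h2
      have huS : u ∈ S := by
        refine ⟨⟨hx0.trans (le_of_lt hu), (hu2 ⟨hu, le_rfl⟩).2.2.le⟩, fun s hs => ?_⟩
        rcases le_or_gt s x with h3 | h3
        · exact hle s ⟨hs.1, h3⟩
        · have h4 := (hu2 ⟨h3, hs.2⟩).1
          calc ‖f s - f 0‖ ≤ ‖f s - f x‖ + ‖f x - f 0‖ := norm_sub_le_norm_sub_add_norm_sub ..
            _ ≤ ε * (g s - g x) + ε * (g x - g 0) := add_le_add h4 hxx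
            _ = _ := by ring
      exact absurd (le_csSup hbdd huS) (not_le.2 hu)
  have h1 : Tendsto (fun ε : ℝ => ε * (g t - g 0)) (𝓝[>] 0) (𝓝 (0 * (g t - g 0))) :=
    (tendsto_id.mono_left nhdsWithin_le_nhds).mul_const _
  rw [zero_mul] at h1
  have h2 := ge_of_tendsto h1 (eventually_nhdsWithin_of_forall fun ε hε => key ε hε)
  exact sub_eq_zero.1 (norm_le_zero_iff.1 h2)

/-- The filter of the `s > t` in `[0,T]`, `s → t`, with `g s ≠ g t`. -/
def rightFilter (g : Derivator) (T t : ℝ) : Filter ℝ := 𝓝[{s | t < s ∧ s ≤ T ∧ g s ≠ g t}] t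

/-- `f` has the right `g`-derivative `f'` at `t`; nothing is required if `g` is constant
immediately to the right of `t`. -/
def HasRightDeriv (g : Derivator) (T : ℝ) (f : ℝ → ℂ) (f' : ℂ) (t : ℝ) : Prop :=
  Tendsto (fun s => (f s - f t) / ((g s - g t : ℝ) : ℂ)) (g.rightFilter T t) (𝓝 f')

theorem rightFilter_le : g.rightFilter T t ≤ 𝓝[>] t := nhdsWithin_mono _ fun _ hs => hs.1

theorem eventually_rightFilter :
    ∀ᶠ s in g.rightFilter T t, t < s ∧ s ≤ T ∧ ((g s - g t : ℝ) : ℂ) ≠ 0 := by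
  filter_upwards [self_mem_nhdsWithin] with s hs
  exact ⟨hs.1, hs.2.1, Complex.ofReal_ne_zero.2 (sub_ne_zero.2 hs.2.2)⟩

theorem tendsto_sub_rightFilter :
    Tendsto (fun s => ((g s - g t : ℝ) : ℂ)) (g.rightFilter T t) (𝓝 (g.jump t : ℂ)) := by
  have h := ((g.tendsto_right t).sub_const (g t)).mono_left (rightFilter_le (g := g) (T := T))
  rw [add_sub_cancel_left] at h
  exact (Complex.continuous_ofReal.tendsto _).comp h

theorem HasRightDeriv.tendsto {f' : ℂ} (hf : g.HasRightDeriv T f f' t) :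
    Tendsto f (g.rightFilter T t) (𝓝 (f t + f' * g.jump t)) := by
  refine ((hf.mul tendsto_sub_rightFilter).const_add (f t)).congr' ?_
  filter_upwards [eventually_rightFilter] with s hs
  rw [div_mul_cancel₀ _ hs.2.2, add_sub_cancel]

/-- In the usual splitting of the increment, `h s` tends to `h t + h' Δg(t)` and not to `h t`, which
produces the jump term. -/
theorem HasRightDeriv.mul {f' h' : ℂ} (hf : g.HasRightDeriv T f f' t)
    (hh : g.HasRightDeriv T h h' t) :
    g.HasRightDeriv T (fun s => f s * h s) (f' * (h t + h' * g.jump t) + f t * h') t := by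
  refine ((Tendsto.mul hf hh.tendsto).add (Tendsto.const_mul (f t) hh)).congr fun s => ?_
  ring

theorem HasRightDeriv.sub {f' h' : ℂ} (hf : g.HasRightDeriv T f f' t)
    (hh : g.HasRightDeriv T h h' t) : g.HasRightDeriv T (fun s => f s - h s) (f' - h') t := by
  refine (Tendsto.sub hf hh).congr fun s => ?_
  ring

theorem MemC.eq_of_hasRightDeriv_zero (hf : g.MemC T f)
    (h : ∀ t ∈ Ico 0 T, g.HasRightDeriv T f 0 t) (ht : t ∈ Icc 0 T) : f t = f 0 := by
  refine hf.eq_of_eventually_le (fun t ht ε hε => ?_) ht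
  have h1 := eventually_nhdsWithin_iff.1 ((h t ht).norm.eventually_lt_const (by simpa using hε))
  filter_upwards [nhdsWithin_le_nhds h1, Ioo_mem_nhdsGT ht.2] with s hs hst
  -- The derivative says nothing about points with `g s = g t`; there `g`-continuity forces equal
  -- values.
  by_cases hg : g s = g t
  · rw [hf.eq_of_eq ⟨ht.1, ht.2.le⟩ ⟨ht.1.trans hst.1.le, hst.2.le⟩ hg]
    simp [hg]
  · have h2 := hs ⟨hst.1, hst.2.le, hg⟩
    have h3 : 0 < g s - g t :=
      lt_of_le_of_ne (sub_nonneg.2 (g.mono hst.1.le)) (Ne.symm (sub_ne_zero.2 hg))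
    rw [norm_div, Complex.norm_real, Real.norm_of_nonneg h3.le, div_lt_iff₀ h3] at h2
    exact h2.le

/-- On `C_g`, where the derivative is read off at `t*`, the right filter is trivial. Elsewhere `t* =
t`, and the right filter is finer than the one defining the derivative. -/
theorem DiffAt.hasRightDeriv (hf : g.DiffAt T f t) (ht : 0 ≤ t) :
    g.HasRightDeriv T f (g.deriv T f t) t := by
  by_cases hc : t ∈ g.constSet
  · obtain ⟨ε, hε, H⟩ := hc
    have h1 : g.rightFilter T t = ⊥ := by
      rw [← empty_mem_iff_bot]
      filter_upwards [eventually_rightFilter,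
        rightFilter_le (Ioo_mem_nhdsGT (show t < t + ε by linarith))] with s hs hs2
      exact hs.2.2 (by rw [H s ⟨by linarith [hs2.1], hs2.2⟩, sub_self, Complex.ofReal_zero])
    rw [HasRightDeriv, h1]
    exact tendsto_bot
  · have h1 : g.star t = t := if_neg hc
    have h2 := tendsto_nhds_limUnder hf
    have h3 : g.rightFilter T t ≤ g.derivFilter T t := by
      rw [derivFilter, h1]
      split_ifs
      · exact nhdsWithin_mono _ fun s hs => ⟨hs.1, hs.2.1⟩
      · exact nhdsWithin_mono _ fun s hs => ⟨⟨ht.trans hs.1.le, hs.2.1⟩, hs.2.2⟩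
    refine (h2.mono_left h3).congr fun s => ?_
    rw [quot, h1]

end Derivator

namespace Derivator

variable {g : Derivator} {T t : ℝ} {p : ℝ → ℂ}

/-! ### The `g`-exponential -/

/-- The exponents for which `gexp` solves its differential equation everywhere on `[0,T)`. -/
structure AdmissibleExponent (g : Derivator) (T : ℝ) (p : ℝ → ℂ) : Prop where
  aemeasurable : AEMeasurable p (g.mu.restrict (Icc 0 T))
  bounded : ∃ M : ℝ, ∀ t ∈ Icc 0 T, ‖p t‖ ≤ M
  regressive : g.Regressive T p
  tendsto_right : ∀ t ∈ Ico 0 T, t ∉ g.jumpSet → Tendsto p (𝓝[>] t) (𝓝 (p t))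

theorem hasDerivAt_log_one_add : HasDerivAt (fun z : ℂ => Complex.log (1 + z)) 1 0 := by
  have h := ((hasDerivAt_id (0 : ℂ)).const_add 1).clog (by simp)
  simpa using h

theorem dslope_log_one_add_zero : dslope (fun z : ℂ => Complex.log (1 + z)) 0 0 = 1 := by
  rw [dslope_same, hasDerivAt_log_one_add.deriv]

theorem measurable_dslope_log_one_add :
    Measurable (dslope (fun z : ℂ => Complex.log (1 + z)) 0) := by
  have h : dslope (fun z : ℂ => Complex.log (1 + z)) 0 =
      fun z => if z = 0 then 1 else Complex.log (1 + z) / z := by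
    ext z
    split_ifs with hz
    · rw [hz, dslope_log_one_add_zero]
    · rw [dslope_of_ne _ hz, slope_def_field, add_zero, Complex.log_one, sub_zero, sub_zero]
  rw [h]
  exact Measurable.ite (measurableSet_singleton 0) measurable_const
    ((Complex.measurable_log.comp (measurable_id.const_add 1)).div measurable_id)

/-- The function `log (1 + z) / z`, extended by 1 at zero, merges the two cases of the definition.
Measurability, bounds and one-sided limits of the integrand are all read off from this form. -/
theorem expIntegrand_eq (p : ℝ → ℂ) (s : ℝ) :
    g.expIntegrand p s = p s * dslope (fun z : ℂ => Complex.log (1 + z)) 0 (p s * g.jump s) := by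
  rw [expIntegrand]
  split_ifs with h
  · have hj : (g.jump s : ℂ) ≠ 0 := Complex.ofReal_ne_zero.2 (ne_of_gt h)
    rcases eq_or_ne (p s) 0 with h0 | h0
    · simp [h0]
    · rw [dslope_of_ne _ (mul_ne_zero h0 hj), slope_def_field, add_zero, Complex.log_one, sub_zero,
        sub_zero]
      field_simp
  · rw [jump_eq_zero h, Complex.ofReal_zero, mul_zero, dslope_log_one_add_zero, mul_one]

theorem tendsto_ofReal_jump_right (t : ℝ) :
    Tendsto (fun s => (g.jump s : ℂ)) (𝓝[>] t) (𝓝 0) := by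
  have h := (Complex.continuous_ofReal.tendsto _).comp (g.tendsto_jump_right t)
  rwa [Complex.ofReal_zero] at h

theorem measurable_ofReal_jump : Measurable fun s => (g.jump s : ℂ) :=
  Complex.measurable_ofReal.comp g.measurable_jump

namespace AdmissibleExponent

variable (hp : g.AdmissibleExponent T p)
include hp

theorem exists_bound_expIntegrand : ∃ M : ℝ, 0 ≤ M ∧ ∀ t ∈ Icc 0 T, ‖g.expIntegrand p t‖ ≤ M := by
  obtain ⟨B, hB⟩ := hp.bounded
  have hB' : ∀ t ∈ Icc 0 T, ‖p t‖ ≤ |B| + 1 :=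
    fun t ht => (hB t ht).trans ((le_abs_self B).trans (by linarith))
  have hpos : 0 < |B| + 1 := by positivity
  have hc : ∀ᶠ z in 𝓝 (0 : ℂ), ‖dslope (fun z : ℂ => Complex.log (1 + z)) 0 z‖ < 2 :=
    (continuousAt_dslope_same.2 hasDerivAt_log_one_add.differentiableAt).norm.eventually_lt_const
      (by simp only [dslope_log_one_add_zero]; norm_num)
  obtain ⟨r, hr, H⟩ := Metric.eventually_nhds_iff.1 hc
  -- This threshold gives `‖p t * Δg(t)‖ < r`, where the divided difference of the logarithm has
  -- norm below 2.
  obtain ⟨M, hM⟩ := exists_bound_of_small_jump (g := g) (T := T) (h := g.expIntegrand p)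
    (c := r / (|B| + 1)) (B := (|B| + 1) * 2) (by positivity) fun t ht hj => by
      rw [expIntegrand_eq, norm_mul]
      refine mul_le_mul (hB' t ht) (H ?_).le (norm_nonneg _) hpos.le
      rw [dist_zero_right, norm_mul, Complex.norm_real, Real.norm_of_nonneg (g.jump_nonneg t)]
      rw [lt_div_iff₀ hpos] at hj
      nlinarith [hB' t ht, g.jump_nonneg t]
  exact ⟨max M 0, le_max_right _ _, fun t ht => (hM t ht).trans (le_max_left _ _)⟩

theorem integrableOn_expIntegrand : IntegrableOn (g.expIntegrand p) (Icc 0 T) g.mu := by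
  obtain ⟨M, -, hM⟩ := hp.exists_bound_expIntegrand
  have hm : AEMeasurable (g.expIntegrand p) (g.mu.restrict (Icc 0 T)) := by
    have h1 := hp.aemeasurable.mul (measurable_dslope_log_one_add.comp_aemeasurable
      (hp.aemeasurable.mul (measurable_ofReal_jump (g := g)).aemeasurable))
    exact h1.congr (Eventually.of_forall fun s => (expIntegrand_eq p s).symm)
  exact IntegrableOn.of_bound isCompact_Icc.measure_lt_top hm.aestronglyMeasurable
    M (ae_restrict_of_forall_mem measurableSet_Icc hM)

theorem integrableOn : IntegrableOn p (Icc 0 T) g.mu := by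
  obtain ⟨M, hM⟩ := hp.bounded
  exact IntegrableOn.of_bound isCompact_Icc.measure_lt_top
    hp.aemeasurable.aestronglyMeasurable M (ae_restrict_of_forall_mem measurableSet_Icc hM)

theorem gexpDefined : g.GexpDefined T p :=
  ⟨hp.regressive, hp.integrableOn.mono_set Ico_subset_Icc_self,
    hp.integrableOn_expIntegrand.mono_set Ico_subset_Icc_self⟩

theorem integral_sub {s : ℝ} (ht : 0 ≤ t) (hts : t ≤ s) (hs : s ≤ T) :
    (∫ u in Ico 0 s, g.expIntegrand p u ∂g.mu) - ∫ u in Ico 0 t, g.expIntegrand p u ∂g.mu =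
      ∫ u in Ico t s, g.expIntegrand p u ∂g.mu := by
  have hI := hp.integrableOn_expIntegrand
  rw [← Ico_union_Ico_eq_Ico ht hts, setIntegral_union
    (Ico_disjoint_Ico_same) measurableSet_Ico
    (hI.mono_set fun u hu => ⟨hu.1, hu.2.le.trans (hts.trans hs)⟩)
    (hI.mono_set fun u hu => ⟨ht.trans hu.1, hu.2.le.trans hs⟩), add_sub_cancel_left]

theorem exists_lipschitz : ∃ M : ℝ, 0 ≤ M ∧ ∀ t s : ℝ, 0 ≤ t → t ≤ s → s ≤ T →
    ‖(∫ u in Ico 0 s, g.expIntegrand p u ∂g.mu) - ∫ u in Ico 0 t, g.expIntegrand p u ∂g.mu‖ ≤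
      M * (g s - g t) := by
  obtain ⟨M, hM0, hM⟩ := hp.exists_bound_expIntegrand
  refine ⟨M, hM0, fun t s ht hts hs => ?_⟩
  rw [hp.integral_sub ht hts hs]
  have h := norm_setIntegral_le_of_norm_le_const (μ := g.mu) (s := Ico t s)
    (f := g.expIntegrand p) (C := M) (by rw [mu_Ico]; exact ENNReal.ofReal_lt_top)
    fun u hu => hM u ⟨ht.trans hu.1, hu.2.le.trans hs⟩
  rwa [measureReal_def, mu_Ico, ENNReal.toReal_ofReal (sub_nonneg.2 (g.mono hts))] at h

theorem memC_integral : g.MemC T fun t => ∫ u in Ico 0 t, g.expIntegrand p u ∂g.mu := by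
  obtain ⟨M, hM0, hM⟩ := hp.exists_lipschitz
  intro t ht ε hε
  have key : ∀ s ∈ Icc 0 T, ‖(∫ u in Ico 0 t, g.expIntegrand p u ∂g.mu) -
      ∫ u in Ico 0 s, g.expIntegrand p u ∂g.mu‖ ≤ M * |g t - g s| := fun s hs => by
    rcases le_total s t with h | h
    · rw [abs_of_nonneg (sub_nonneg.2 (g.mono h))]
      exact hM s t hs.1 h ht.2
    · rw [abs_of_nonpos (sub_nonpos.2 (g.mono h)), neg_sub, norm_sub_rev]
      exact hM t s ht.1 h hs.2
  refine ⟨ε / (M + 1), by positivity, fun s hs hst => (key s hs).trans_lt ?_⟩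
  rw [lt_div_iff₀ (by positivity)] at hst
  nlinarith [abs_nonneg (g t - g s)]

theorem memC_gexp : g.MemC T (g.gexp p) :=
  memC_iff.2 fun t ht =>
    (Complex.continuous_exp.tendsto _).comp (memC_iff.1 hp.memC_integral t ht)

theorem exists_bound_gexp : ∃ M : ℝ, ∀ t ∈ Icc 0 T, ‖g.gexp p t‖ ≤ M := by
  obtain ⟨M, hM0, hM⟩ := hp.exists_lipschitz
  refine ⟨Real.exp (M * (g T - g 0)), fun t ht => ?_⟩
  rw [gexp, Complex.norm_exp]
  refine Real.exp_le_exp.2 ((Complex.re_le_norm _).trans ?_)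
  have h := hM 0 t le_rfl ht.1 ht.2
  rw [Ico_self, setIntegral_empty, sub_zero] at h
  exact h.trans (mul_le_mul_of_nonneg_left (sub_le_sub_right (g.mono ht.2) _) hM0)

/-- Subtracting the value of the integrand at `t` removes the contribution of the atom at `t`; what
remains lives on the open interval, whose mass omits the jump. -/
theorem norm_integral_sub_le {s C : ℝ} (ht : 0 ≤ t) (hts : t < s) (hs : s ≤ T)
    (hC : ∀ u ∈ Ioo t s, ‖g.expIntegrand p u - g.expIntegrand p t‖ ≤ C) :
    ‖(∫ u in Ico 0 s, g.expIntegrand p u ∂g.mu) - (∫ u in Ico 0 t, g.expIntegrand p u ∂g.mu) -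
      g.expIntegrand p t * ((g s - g t : ℝ) : ℂ)‖ ≤ C * (g s - g t - g.jump t) := by
  have hfin : g.mu (Ico t s) < ⊤ := by rw [mu_Ico]; exact ENNReal.ofReal_lt_top
  have h1 : ∫ u in Ico t s, (g.expIntegrand p u - g.expIntegrand p t) ∂g.mu =
      (∫ u in Ico t s, g.expIntegrand p u ∂g.mu) -
        g.expIntegrand p t * ((g s - g t : ℝ) : ℂ) := by
    rw [MeasureTheory.integral_sub
      (hp.integrableOn_expIntegrand.mono_set fun u hu => ⟨ht.trans hu.1, hu.2.le.trans hs⟩)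
      (integrableOn_const hfin.ne), setIntegral_const, measureReal_def, mu_Ico,
      ENNReal.toReal_ofReal (sub_nonneg.2 (g.mono hts.le)), Complex.real_smul, mul_comm]
  rw [hp.integral_sub ht hts.le hs, ← h1,
    setIntegral_eq_of_subset_of_forall_sdiff_eq_zero (s := Ioo t s) measurableSet_Ico
      Ioo_subset_Ico_self fun u hu => by
        have h2 : u = t := by
          by_contra hne
          exact hu.2 ⟨lt_of_le_of_ne hu.1.1 (Ne.symm hne), hu.1.2⟩
        rw [h2, sub_self]]
  have h3 := norm_setIntegral_le_of_norm_le_const (μ := g.mu) (s := Ioo t s)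
    (by rw [mu_Ioo]; exact ENNReal.ofReal_lt_top) hC
  have h4 : 0 ≤ g s - g t - g.jump t := by
    have := g.mono.rightLim_le hts
    rw [rightLim_eq] at this
    linarith
  rwa [measureReal_def, mu_Ioo, ENNReal.toReal_ofReal h4] at h3

theorem tendsto_expIntegrand_right (ht : t ∈ Ico 0 T) (hj : t ∉ g.jumpSet) :
    Tendsto (g.expIntegrand p) (𝓝[>] t) (𝓝 (g.expIntegrand p t)) := by
  have h1 := hp.tendsto_right t ht hj
  have h2 := h1.mul (tendsto_ofReal_jump_right (g := g) t)
  rw [mul_zero] at h2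
  have h3 := h1.mul
    ((continuousAt_dslope_same.2 hasDerivAt_log_one_add.differentiableAt).tendsto.comp h2)
  refine (h3.congr fun s => (expIntegrand_eq p s).symm).trans_eq ?_
  rw [expIntegrand_eq, jump_eq_zero hj, Complex.ofReal_zero, mul_zero]

/-- At a jump, the mass of `(t,s)` tends to zero while `g s - g t` tends to a positive number, so
boundedness of the integrand is enough. Elsewhere its right continuity makes the error small
relative to `g s - g t`. -/
theorem hasRightDeriv_integral (ht : t ∈ Ico 0 T) :
    g.HasRightDeriv T (fun t => ∫ u in Ico 0 t, g.expIntegrand p u ∂g.mu)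
      (g.expIntegrand p t) t := by
  have hquot : ∀ {s : ℝ} {C : ℝ}, 0 < g s - g t →
      ‖(∫ u in Ico 0 s, g.expIntegrand p u ∂g.mu) - (∫ u in Ico 0 t, g.expIntegrand p u ∂g.mu) -
        g.expIntegrand p t * ((g s - g t : ℝ) : ℂ)‖ ≤ C →
      ‖((∫ u in Ico 0 s, g.expIntegrand p u ∂g.mu) - ∫ u in Ico 0 t, g.expIntegrand p u ∂g.mu) /
        ((g s - g t : ℝ) : ℂ) - g.expIntegrand p t‖ ≤ C / (g s - g t) := by
    intro s C hpos hle
    have hne : ((g s - g t : ℝ) : ℂ) ≠ 0 := Complex.ofReal_ne_zero.2 hpos.ne'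
    rw [div_sub' hne, norm_div, Complex.norm_real, Real.norm_of_nonneg hpos.le,
      mul_comm _ (g.expIntegrand p t)]
    exact div_le_div_of_nonneg_right hle hpos.le
  have hpos : ∀ᶠ s in g.rightFilter T t, t < s ∧ s ≤ T ∧ 0 < g s - g t := by
    filter_upwards [eventually_rightFilter] with s hs
    exact ⟨hs.1, hs.2.1, lt_of_le_of_ne (sub_nonneg.2 (g.mono hs.1.le))
      (Ne.symm (Complex.ofReal_ne_zero.1 hs.2.2))⟩
  rw [HasRightDeriv, tendsto_iff_norm_sub_tendsto_zero]
  by_cases hj : t ∈ g.jumpSet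
  · obtain ⟨M, hM0, hM⟩ := hp.exists_bound_expIntegrand
    have hd : Tendsto (fun s => g s - g t) (g.rightFilter T t) (𝓝 (g.jump t)) := by
      have h := ((g.tendsto_right t).sub_const (g t)).mono_left (rightFilter_le (g := g) (T := T))
      rwa [add_sub_cancel_left] at h
    have hlim : Tendsto (fun s => (M + M) * (g s - g t - g.jump t) / (g s - g t))
        (g.rightFilter T t) (𝓝 0) := by
      have h := ((hd.sub_const (g.jump t)).const_mul (M + M)).div hd (ne_of_gt hj)
      rwa [sub_self, mul_zero, zero_div] at h
    refine squeeze_zero' (Eventually.of_forall fun s => norm_nonneg _) ?_ hlim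
    filter_upwards [hpos] with s hs
    refine hquot hs.2.2 (hp.norm_integral_sub_le ht.1 hs.1 hs.2.1 fun u hu => ?_)
    exact (norm_sub_le _ _).trans (add_le_add
      (hM u ⟨ht.1.trans hu.1.le, hu.2.le.trans hs.2.1⟩) (hM t ⟨ht.1, ht.2.le⟩))
  · rw [Metric.tendsto_nhds]
    intro ε hε
    have h1 := (tendsto_iff_norm_sub_tendsto_zero.1
      (hp.tendsto_expIntegrand_right ht hj)).eventually_lt_const (half_pos hε)
    obtain ⟨v, hv, hv2⟩ := mem_nhdsGT_iff_exists_Ioo_subset.1 h1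
    filter_upwards [hpos, rightFilter_le (Ioo_mem_nhdsGT hv)] with s hs hsv
    have h2 := hquot hs.2.2 (hp.norm_integral_sub_le ht.1 hs.1 hs.2.1 fun u hu =>
      (hv2 ⟨hu.1, hu.2.trans hsv.2⟩).le)
    rw [jump_eq_zero hj, sub_zero, mul_div_cancel_right₀ _ hs.2.2.ne'] at h2
    rw [dist_zero_right, norm_norm]
    linarith

theorem hasRightDeriv_gexp (ht : t ∈ Ico 0 T) :
    g.HasRightDeriv T (g.gexp p) (p t * g.gexp p t) t := by
  have hI := hp.hasRightDeriv_integral ht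
  by_cases hj : t ∈ g.jumpSet
  -- At a jump, exponentiating the logarithm gives the right limit `gexp p t * (1 + p t * Δg(t))`;
  -- regressivity keeps the logarithm away from 0.
  · have hj0 : (g.jump t : ℂ) ≠ 0 := Complex.ofReal_ne_zero.2 (ne_of_gt hj)
    have h1 : Tendsto (g.gexp p) (g.rightFilter T t)
        (𝓝 (g.gexp p t * (1 + p t * g.jump t))) := by
      refine ((Complex.continuous_exp.tendsto _).comp hI.tendsto).trans_eq ?_
      rw [Complex.exp_add, expIntegrand, if_pos hj, div_mul_cancel₀ _ hj0,
        Complex.exp_log (hp.regressive t ⟨⟨ht.1, ht.2.le⟩, hj⟩), gexp]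
    refine ((h1.sub_const (g.gexp p t)).div tendsto_sub_rightFilter hj0).trans_eq ?_
    congr 1
    field_simp
    ring
  · have h1 : Tendsto (fun s => (∫ u in Ico 0 s, g.expIntegrand p u ∂g.mu) -
        ∫ u in Ico 0 t, g.expIntegrand p u ∂g.mu) (g.rightFilter T t) (𝓝 0) := by
      have h := hI.tendsto.sub_const (∫ u in Ico 0 t, g.expIntegrand p u ∂g.mu)
      rwa [jump_eq_zero hj, Complex.ofReal_zero, mul_zero, add_zero, sub_self] at h
    -- Chain rule through the divided difference of `exp`, which stays valid where the increment of
    -- the integral is zero.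
    have h2 := (continuousAt_dslope_same.2
      (Complex.differentiable_exp (0 : ℂ))).tendsto.comp h1
    rw [dslope_same, Complex.deriv_exp, Complex.exp_zero] at h2
    have h3 := (Tendsto.mul hI h2).mul_const (g.gexp p t)
    rw [mul_one, expIntegrand, if_neg hj] at h3
    refine h3.congr fun s => ?_
    have h4 := sub_smul_dslope Complex.exp 0 ((∫ u in Ico 0 s, g.expIntegrand p u ∂g.mu) -
        ∫ u in Ico 0 t, g.expIntegrand p u ∂g.mu)
    rw [sub_zero, smul_eq_mul, Complex.exp_zero] at h4
    have h5 : g.gexp p s = Complex.exp ((∫ u in Ico 0 s, g.expIntegrand p u ∂g.mu) -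
        ∫ u in Ico 0 t, g.expIntegrand p u ∂g.mu) * g.gexp p t := by
      rw [gexp, gexp, ← Complex.exp_add, sub_add_cancel]
    rw [h5, Function.comp_apply, div_mul_eq_mul_div, h4]
    ring

/-- The exponent of the inverse of `gexp p` is admissible. -/
theorem inverse : g.AdmissibleExponent T fun s => -(p s / (1 + p s * g.jump s)) := by
  obtain ⟨B, hB⟩ := hp.bounded
  have hB' : ∀ t ∈ Icc 0 T, ‖p t‖ ≤ |B| + 1 :=
    fun t ht => (hB t ht).trans ((le_abs_self B).trans (by linarith))
  have hpos : 0 < |B| + 1 := by positivity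
  refine ⟨?_, ?_, ?_, ?_⟩
  · exact (hp.aemeasurable.div ((hp.aemeasurable.mul
      measurable_ofReal_jump.aemeasurable).const_add 1)).neg
  -- The threshold makes `‖p t * Δg(t)‖ ≤ 1/2`, so the denominator has norm at least `1/2`.
  · refine exists_bound_of_small_jump (g := g) (c := 1 / (2 * (|B| + 1))) (B := 2 * (|B| + 1))
      (by positivity) fun t ht hj => ?_
    have h1 : ‖p t * g.jump t‖ ≤ 1 / 2 := by
      rw [norm_mul, Complex.norm_real, Real.norm_of_nonneg (g.jump_nonneg t)]
      rw [lt_div_iff₀ (by positivity)] at hj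
      nlinarith [hB' t ht, g.jump_nonneg t]
    have h2 : 1 / 2 ≤ ‖1 + p t * g.jump t‖ := by
      have := norm_sub_le (1 + p t * g.jump t) (p t * g.jump t)
      rw [add_sub_cancel_right, norm_one] at this
      linarith
    rw [norm_neg, norm_div, div_le_iff₀ (by linarith)]
    nlinarith [hB' t ht]
  · intro t ht
    have h := hp.regressive t ht
    have h1 : 1 + -(p t / (1 + p t * g.jump t)) * g.jump t = (1 + p t * g.jump t)⁻¹ := by
      field_simp
      ring
    rw [h1]
    exact inv_ne_zero h
  · intro t ht hj
    have h1 := hp.tendsto_right t ht hj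
    have h2 := (h1.mul (tendsto_ofReal_jump_right (g := g) t)).const_add 1
    rw [mul_zero, add_zero] at h2
    refine (h1.div h2 one_ne_zero).neg.trans_eq ?_
    rw [jump_eq_zero hj, Complex.ofReal_zero, mul_zero, add_zero]

theorem one_add_ne_zero (ht : t ∈ Icc 0 T) : 1 + p t * g.jump t ≠ 0 := by
  by_cases hj : t ∈ g.jumpSet
  · exact hp.regressive t ⟨ht, hj⟩
  · simp [jump_eq_zero hj]

/-- A solution of `f_g' = p f` times the exponential of the inverse exponent is constant. -/
theorem mul_gexp_inverse_eq {f : ℝ → ℂ} (hf : g.MemC T f)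
    (h : ∀ t ∈ Ico 0 T, g.HasRightDeriv T f (p t * f t) t) (ht : t ∈ Icc 0 T) :
    f t * g.gexp (fun s => -(p s / (1 + p s * g.jump s))) t = f 0 := by
  have hq := hp.inverse
  have h1 := (hf.mul hq.memC_gexp).eq_of_hasRightDeriv_zero (fun t ht => ?_) ht
  · rw [h1, gexp, Ico_self, setIntegral_empty, Complex.exp_zero, mul_one]
  · have h2 := (h t ht).mul (hq.hasRightDeriv_gexp ht)
    have h3 := hp.one_add_ne_zero ⟨ht.1, ht.2.le⟩
    -- The product rule leaves the factor `p (1 + q Δg) + q`, with `q` the inverse exponent; it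
    -- vanishes because `1 + q Δg = 1 / (1 + p Δg)`.
    convert h2 using 1
    field_simp
    ring

/-- The constancy result applies to `gexp p` itself, so no identity between principal logarithms is
needed. -/
theorem gexp_mul_gexp_inverse (ht : t ∈ Icc 0 T) :
    g.gexp p t * g.gexp (fun s => -(p s / (1 + p s * g.jump s))) t = 1 := by
  rw [hp.mul_gexp_inverse_eq hp.memC_gexp (fun t ht => hp.hasRightDeriv_gexp ht) ht, gexp,
    Ico_self, setIntegral_empty, Complex.exp_zero]

theorem exists_bound_inv_one_add : ∃ M : ℝ, ∀ t ∈ Icc 0 T, ‖(1 + p t * g.jump t)⁻¹‖ ≤ M := by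
  obtain ⟨B, hB⟩ := hp.inverse.bounded
  refine exists_bound_of_small_jump (g := g) (c := 1) (B := 1 + |B|) one_pos fun t ht hj => ?_
  -- In this form the bound on the inverse exponent applies directly.
  have h1 : (1 + p t * g.jump t)⁻¹ = 1 + -(p t / (1 + p t * g.jump t)) * g.jump t := by
    have := hp.one_add_ne_zero ht
    field_simp
    ring
  rw [h1]
  refine (norm_add_le _ _).trans ?_
  rw [norm_one, norm_mul, Complex.norm_real, Real.norm_of_nonneg (g.jump_nonneg t)]
  have h2 := (hB t ht).trans (le_abs_self B)
  nlinarith [g.jump_nonneg t, abs_nonneg B]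

end AdmissibleExponent

end Derivator

namespace Derivator

variable {g : Derivator} {T t : ℝ} {P Q y₁ y₂ : ℝ → ℂ}

/-! ### Wronskians -/

theorem simpleWronskian_eq (t : ℝ) : g.simpleWronskian T y₁ y₂ t =
    y₁ t * g.iterDeriv T 1 y₂ t - y₂ t * g.iterDeriv T 1 y₁ t := by
  rw [simpleWronskian, Matrix.det_fin_two_of]

theorem wronskian_eq (hy₁ : g.IsSolution T P Q (fun _ => 0) y₁)
    (hy₂ : g.IsSolution T P Q (fun _ => 0) y₂) (ht : t ∈ Icc 0 T) :
    g.wronskian T y₁ y₂ t =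
      (1 - P t * g.jump t + Q t * (g.jump t : ℂ) ^ 2) * g.simpleWronskian T y₁ y₂ t := by
  have h1 := hy₁.2 t ht
  have h2 := hy₂.2 t ht
  rw [simpleWronskian_eq, wronskian, Matrix.det_fin_three]
  simp only [Matrix.of_apply, Matrix.cons_val]
  -- The coefficients are the cofactors of the two second derivatives in the last row.
  linear_combination (-y₂ t * g.jump t - (g.jump t : ℂ) ^ 2 * g.iterDeriv T 1 y₂ t) * h1 +
    (y₁ t * g.jump t + (g.jump t : ℂ) ^ 2 * g.iterDeriv T 1 y₁ t) * h2

theorem IsSolution.memC {f v : ℝ → ℂ} (hv : g.IsSolution T P Q f v) : g.MemC T v :=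
  hv.1.1.1.1

theorem IsSolution.memC_iterDeriv_one {f v : ℝ → ℂ} (hv : g.IsSolution T P Q f v) :
    g.MemC T (g.iterDeriv T 1 v) :=
  hv.1.1.1.2.2

theorem memC_simpleWronskian {f₁ f₂ : ℝ → ℂ} (hy₁ : g.IsSolution T P Q f₁ y₁)
    (hy₂ : g.IsSolution T P Q f₂ y₂) : g.MemC T (g.simpleWronskian T y₁ y₂) := by
  rw [funext fun t => simpleWronskian_eq (g := g) (T := T) (y₁ := y₁) (y₂ := y₂) t]
  exact (hy₁.memC.mul hy₂.memC_iterDeriv_one).sub (hy₂.memC.mul hy₁.memC_iterDeriv_one)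

/-- The products of first derivatives cancel, leaving `(y₁ + Δg y₁') y₂'' - (y₂ + Δg y₂') y₁''`; the
jump terms produce `Q Δg` once the equation is inserted. -/
theorem hasRightDeriv_simpleWronskian (hy₁ : g.IsSolution T P Q (fun _ => 0) y₁)
    (hy₂ : g.IsSolution T P Q (fun _ => 0) y₂) (ht : t ∈ Icc 0 T) :
    g.HasRightDeriv T (g.simpleWronskian T y₁ y₂)
      ((-P t + Q t * g.jump t) * g.simpleWronskian T y₁ y₂ t) t := by
  have h1 := hy₁.2 t ht
  have h2 := hy₂.2 t ht
  have d1 : g.HasRightDeriv T y₁ (g.iterDeriv T 1 y₁ t) t :=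
    (hy₁.1.1.1.2.1 t ht).hasRightDeriv ht.1
  have d2 : g.HasRightDeriv T y₂ (g.iterDeriv T 1 y₂ t) t :=
    (hy₂.1.1.1.2.1 t ht).hasRightDeriv ht.1
  have e1 : g.HasRightDeriv T (g.iterDeriv T 1 y₁) (g.iterDeriv T 2 y₁ t) t :=
    (hy₁.1.1.2.1 t ht).hasRightDeriv ht.1
  have e2 : g.HasRightDeriv T (g.iterDeriv T 1 y₂) (g.iterDeriv T 2 y₂ t) t :=
    (hy₂.1.1.2.1 t ht).hasRightDeriv ht.1
  have h := (d1.mul e2).sub (d2.mul e1)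
  rw [funext fun t => simpleWronskian_eq (g := g) (T := T) (y₁ := y₁) (y₂ := y₂) t]
  convert h using 1
  linear_combination (y₂ t + g.jump t * g.iterDeriv T 1 y₂ t) * h1 -
    (y₁ t + g.jump t * g.iterDeriv T 1 y₁ t) * h2

theorem one_sub_add_eq (t : ℝ) : 1 - P t * g.jump t + Q t * (g.jump t : ℂ) ^ 2 =
    1 + (-P t + Q t * g.jump t) * g.jump t := by
  ring

theorem admissibleExponent_of_memBC (hP : g.MemBC T P) (hQ : g.MemBC T Q)
    (hreg : ∀ t ∈ Icc 0 T ∩ g.jumpSet, 1 - P t * g.jump t + Q t * (g.jump t : ℂ) ^ 2 ≠ 0) :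
    g.AdmissibleExponent T fun s => -P s + Q s * g.jump s := by
  refine ⟨hP.1.aemeasurable.neg.add (hQ.1.aemeasurable.mul measurable_ofReal_jump.aemeasurable),
    ?_, fun t ht => by rw [← one_sub_add_eq]; exact hreg t ht, fun t ht hj => ?_⟩
  · obtain ⟨A, hA⟩ := hP.2
    obtain ⟨B, hB⟩ := hQ.2
    refine exists_bound_of_small_jump (g := g) (c := 1) (B := A + B) one_pos fun t ht hj => ?_
    refine (norm_add_le _ _).trans (add_le_add (by rw [norm_neg]; exact hA t ht) ?_)
    rw [norm_mul, Complex.norm_real, Real.norm_of_nonneg (g.jump_nonneg t)]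
    exact (mul_le_of_le_one_right (norm_nonneg _) hj.le).trans (hB t ht)
  -- Off the jumps, `P` and `Q` are continuous from the right because `g` is, and the jumps to the
  -- right of `t` tend to zero.
  · have hev : ∀ᶠ s in 𝓝[>] t, s ∈ Icc 0 T :=
      mem_of_superset (Ioo_mem_nhdsGT ht.2) fun s hs => ⟨ht.1.trans hs.1.le, hs.2.le⟩
    have hg : Tendsto g.toFun (𝓝[>] t) (𝓝 (g t)) :=
      (continuousAt_of_notMem_jumpSet hj).mono_left nhdsWithin_le_nhds
    have ht' : t ∈ Icc 0 T := ⟨ht.1, ht.2.le⟩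
    refine ((hP.1.tendsto ht' hev hg).neg.add
      ((hQ.1.tendsto ht' hev hg).mul (tendsto_ofReal_jump_right t))).trans_eq ?_
    rw [jump_eq_zero hj, Complex.ofReal_zero]

end Derivator

theorem mainTheorem3 (g : Derivator) (T : ℝ) (hT : 0 < T)
    (h0 : (0 : ℝ) ∉ g.jumpSet ∪ g.leftEnds)
    (hTg : T ∉ g.rightEnds ∪ g.jumpSet ∪ g.constSet)
    (P Q : ℝ → ℂ) (hP : g.MemBC T P) (hQ : g.MemBC T Q)
    (y₁ y₂ : ℝ → ℂ)
    (hy₁ : g.IsSolution T P Q (fun _ => 0) y₁)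
    (hy₂ : g.IsSolution T P Q (fun _ => 0) y₂) :
    (∀ t ∈ Set.Icc 0 T, g.wronskian T y₁ y₂ t =
      (1 - P t * g.jump t + Q t * (g.jump t : ℂ) ^ 2) * g.simpleWronskian T y₁ y₂ t) ∧
    ((∀ t ∈ Set.Icc 0 T ∩ g.jumpSet,
        1 - P t * g.jump t + Q t * (g.jump t : ℂ) ^ 2 ≠ 0) →
      g.GexpDefined T (fun s => -P s + Q s * g.jump s) ∧
      (∀ t ∈ Set.Icc 0 T, g.simpleWronskian T y₁ y₂ t =
        g.simpleWronskian T y₁ y₂ 0 * g.gexp (fun s => -P s + Q s * g.jump s) t) ∧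
      (g.simpleWronskian T y₁ y₂ 0 ≠ 0 →
        (∀ t ∈ Set.Icc 0 T, g.wronskian T y₁ y₂ t ≠ 0) ∧
        g.GexpDefined T (fun s => -((-P s + Q s * g.jump s) /
          (1 - P s * g.jump s + Q s * (g.jump s : ℂ) ^ 2))) ∧
        (∀ t ∈ Set.Icc 0 T, (g.wronskian T y₁ y₂ t)⁻¹ =
          (g.simpleWronskian T y₁ y₂ 0 *
            (1 - P t * g.jump t + Q t * (g.jump t : ℂ) ^ 2))⁻¹ *
          g.gexp (fun s => -((-P s + Q s * g.jump s) /
            (1 - P s * g.jump s + Q s * (g.jump s : ℂ) ^ 2))) t) ∧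
        (∃ M : ℝ, ∀ t ∈ Set.Icc 0 T, ‖(g.wronskian T y₁ y₂ t)⁻¹‖ ≤ M) ∧
        (∀ t ∈ Set.Icc 0 T \ g.jumpSet,
          ContinuousWithinAt (fun s => (g.wronskian T y₁ y₂ s)⁻¹) (Set.Icc 0 T) t))) := by
  refine ⟨fun t ht => Derivator.wronskian_eq hy₁ hy₂ ht, fun hreg => ?_⟩
  have hp := Derivator.admissibleExponent_of_memBC hP hQ hreg
  have hden : ∀ t ∈ Icc 0 T, 1 - P t * g.jump t + Q t * (g.jump t : ℂ) ^ 2 ≠ 0 := fun t ht => by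
    rw [Derivator.one_sub_add_eq]; exact hp.one_add_ne_zero ht
  have hinv : (fun s => -((-P s + Q s * g.jump s) /
      (1 - P s * g.jump s + Q s * (g.jump s : ℂ) ^ 2))) =
      fun s => -((-P s + Q s * g.jump s) / (1 + (-P s + Q s * g.jump s) * g.jump s)) := by
    ext s
    rw [Derivator.one_sub_add_eq]
  have hq := hp.inverse
  have hmul := fun t (ht : t ∈ Icc 0 T) => hp.gexp_mul_gexp_inverse ht
  have hconst := fun t (ht : t ∈ Icc 0 T) =>
    hp.mul_gexp_inverse_eq (Derivator.memC_simpleWronskian hy₁ hy₂)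
      (fun t ht => Derivator.hasRightDeriv_simpleWronskian hy₁ hy₂ ⟨ht.1, ht.2.le⟩) ht
  rw [hinv]
  set q : ℝ → ℂ :=
    fun s => -((-P s + Q s * g.jump s) / (1 + (-P s + Q s * g.jump s) * g.jump s))
  have hW0 : g.simpleWronskian T y₁ y₂ 0 ≠ 0 → ∀ t ∈ Icc 0 T, g.wronskian T y₁ y₂ t ≠ 0 := by
    intro h0 t ht
    rw [Derivator.wronskian_eq hy₁ hy₂ ht]
    refine mul_ne_zero (hden t ht) fun h => h0 ?_
    rw [← hconst t ht, h, zero_mul]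
  have hWinv : g.simpleWronskian T y₁ y₂ 0 ≠ 0 → ∀ t ∈ Icc 0 T, (g.wronskian T y₁ y₂ t)⁻¹ =
      (g.simpleWronskian T y₁ y₂ 0 *
        (1 - P t * g.jump t + Q t * (g.jump t : ℂ) ^ 2))⁻¹ * g.gexp q t := by
    intro h0 t ht
    have h1 : g.gexp q t ≠ 0 := Complex.exp_ne_zero _
    rw [Derivator.wronskian_eq hy₁ hy₂ ht, ← hconst t ht, mul_inv, mul_inv, mul_inv,
      mul_right_comm, mul_assoc _ (g.gexp q t)⁻¹, inv_mul_cancel₀ h1, mul_one, mul_comm]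
  refine ⟨hp.gexpDefined, fun t ht => ?_, fun h0 => ⟨hW0 h0, hq.gexpDefined, hWinv h0, ?_, ?_⟩⟩
  -- The simple Wronskian times `gexp q` is its initial value; multiplying by the exponential of the
  -- original exponent cancels `gexp q`.
  · rw [← hconst t ht, mul_assoc, mul_comm (g.gexp q t), hmul t ht, mul_one]
  · obtain ⟨A, hA⟩ := hq.exists_bound_gexp
    obtain ⟨B, hB⟩ := hp.exists_bound_inv_one_add
    refine ⟨‖(g.simpleWronskian T y₁ y₂ 0)⁻¹‖ * B * A, fun t ht => ?_⟩
    have hB0 : 0 ≤ B := (norm_nonneg _).trans (hB t ht)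
    rw [hWinv h0 t ht, mul_inv, norm_mul, norm_mul, Derivator.one_sub_add_eq]
    gcongr
    · exact hB t ht
    · exact hA t ht
  · intro t ht
    -- Continuity is proved for the factored Wronskian and then inverted, so no continuity of the
    -- second derivatives is involved.
    have hΔ : ContinuousWithinAt (fun s => (g.jump s : ℂ)) (Icc 0 T) t :=
      (Complex.continuous_ofReal.continuousAt.comp
        (Derivator.continuousAt_jump ht.2)).continuousWithinAt
    have hcont := ((continuousWithinAt_const (b := (1 : ℂ))).sub
      ((hP.1.continuousWithinAt ht.1 ht.2).mul hΔ)).add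
      ((hQ.1.continuousWithinAt ht.1 ht.2).mul (hΔ.pow 2)) |>.mul
      ((Derivator.memC_simpleWronskian hy₁ hy₂).continuousWithinAt ht.1 ht.2)
    exact (hcont.congr (fun s hs => Derivator.wronskian_eq hy₁ hy₂ hs)
      (Derivator.wronskian_eq hy₁ hy₂ ht.1)).inv₀ (hW0 h0 t ht.1)
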